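/- Let $G$ be a finite or countable directed graph (countably many vertices and edges; loops and multiple edges are allowed). Let $\mathbb F^+(G)$ be the set of all finite directed paths in $G$, including the vertices as paths of length $0$, where $wv$ denotes the path "first $v$, then $w$", defined when the final vertex of $v$ is the initial vertex of $w$. Let $\mathcal H_G=\ell^2(\mathbb F^+(G))$ with orthonormal basis $\{\xi_w\}$, and for an edge or vertex $u$ let $L_u$ be the bounded operator on $\mathcal H_G$ with $L_u\xi_w=\xi_{uw}$ if $uw$ is defined and $L_u\xi_w=0$ otherwise. Let $\mathcal A_G$ be the norm-closed algebra generated by all $L_e$ ($e$ an edge) and $L_x$ ($x$ a vertex); it need not contain the identity operator. Let $\mathcal A_2$ be the algebra $\mathcal A_{G}$ for the graph with a single vertex and two distinct loop edges (the noncommutative disc algebra). A cycle at a vertex $x$ is a path of at least one edge from $x$ to $x$ for which only the initial edge has source vertex $x$. Theorem. The following assertions are equivalent: (i) $G$ contains a double-cycle, that is, there are two distinct cycles at some vertex of $G$. (ii) $\mathcal A_G$ is partly free, that is, there is an injective $*$-homomorphism $\varphi: C^*(\mathcal A_2)\to C^*(\mathcal A_G)$ (not required to preserve units) between the C*-algebras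 generated by $\mathcal A_2$ and by $\mathcal A_G$ on their Fock spaces, such that $\varphi(\mathcal A_2)\subseteq\mathcal A_G$. (iii) There are nonzero partial isometries $U,V$ in $\mathcal A_G$ with $$U^*U=V^*V,\qquad UU^*\le U^*U,\qquad VV^*\le V^*V,\qquad U^*V=0.$$ -/

import Mathlib

open Quiver

noncomputable section

namespace QuiverAlgebra

/-- The set of elements of the free semigroupoid of a directed graph (a `Quiver`): all finite
directed paths, the paths of length zero being the vertices. A triple `⟨a, b, p⟩` is a path `p`
with initial vertex `a` and final vertex `b`. -/
abbrev FreeSemigroupoid (V : Type*) [Quiver V] := Σ a b : V, Path a b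

/-- The Fock space `ℓ²` of the free semigroupoid. -/
abbrev FockSpace (V : Type*) [Quiver V] := lp (fun _ : FreeSemigroupoid V => ℂ) 2

open Classical in
/-- The standard orthonormal basis vector `ξ_w`. -/
def ξ {V : Type*} [Quiver V] (w : FreeSemigroupoid V) : FockSpace V :=
  lp.single 2 w (1 : ℂ)

open Classical in
/-- The operator on `ℓ²(α)` induced by a partially defined injective map `f` of `α`: it maps the
basis vector at `a` to the basis vector at `f a` when `f a` is defined, and to `0` otherwise.
In coordinates, `(T g) b = g a` if `f a = b`, and `(T g) b = 0` if `b` is not a value of `f`. -/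
def partialShiftFun {α : Type*} (f : α → Option α) (g : α → ℂ) (b : α) : ℂ :=
  if h : ∃ a, f a = some b then g h.choose else 0

theorem partialShiftFun_apply {α : Type*} (f : α → Option α)
    (hf : ∀ a a' b, f a = some b → f a' = some b → a = a') (g : α → ℂ) {a b : α}
    (h : f a = some b) : partialShiftFun f g b = g a := by
  have hex : ∃ a, f a = some b := ⟨a, h⟩
  rw [partialShiftFun, dif_pos hex, hf _ _ _ hex.choose_spec h]

theorem partialShiftFun_of_not {α : Type*} (f : α → Option α) (g : α → ℂ) {b : α}
    (h : ¬ ∃ a, f a = some b) : partialShiftFun f g b = 0 := by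
  rw [partialShiftFun, dif_neg h]

theorem sum_partialShiftFun_le {α : Type*} (f : α → Option α)
    (g : lp (fun _ : α => ℂ) 2) (s : Finset α) :
    ∑ b ∈ s, ‖partialShiftFun f g b‖ ^ (2 : ENNReal).toReal
      ≤ ‖g‖ ^ (2 : ENNReal).toReal := by
  classical
  let c : α → α := fun b => if h : ∃ a, f a = some b then h.choose else b
  have hc : ∀ b, (∃ a, f a = some b) → f (c b) = some b := by
    intro b hb
    have : c b = hb.choose := dif_pos hb
    rw [this]
    exact hb.choose_spec
  have hval : ∀ b, (∃ a, f a = some b) → partialShiftFun f g b = g (c b) := by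
    intro b hb
    have : c b = hb.choose := dif_pos hb
    rw [this, partialShiftFun, dif_pos hb]
  have h2 : (0 : ℝ) < (2 : ENNReal).toReal := by norm_num
  calc ∑ b ∈ s, ‖partialShiftFun f g b‖ ^ (2 : ENNReal).toReal
      = ∑ b ∈ s.filter (fun b => ∃ a, f a = some b),
          ‖partialShiftFun f g b‖ ^ (2 : ENNReal).toReal := by
        refine (Finset.sum_filter_of_ne ?_).symm
        intro b _ hne
        by_contra hb
        apply hne
        rw [partialShiftFun_of_not f g hb, norm_zero, Real.zero_rpow h2.ne']
    _ = ∑ b ∈ s.filter (fun b => ∃ a, f a = some b), ‖g (c b)‖ ^ (2 : ENNReal).toReal := by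
        refine Finset.sum_congr rfl ?_
        intro b hb
        rw [hval b (Finset.mem_filter.1 hb).2]
    _ = ∑ a ∈ (s.filter (fun b => ∃ a, f a = some b)).image c,
          ‖g a‖ ^ (2 : ENNReal).toReal := by
        symm
        apply Finset.sum_image
        intro b hb b' hb' hbb
        have h1 := hc b (Finset.mem_filter.1 hb).2
        have h3 := hc b' (Finset.mem_filter.1 hb').2
        rw [hbb, h3] at h1
        exact (Option.some.inj h1).symm
    _ ≤ ‖g‖ ^ (2 : ENNReal).toReal := lp.sum_rpow_le_norm_rpow h2 g _

/-- The partially defined shift as a bounded operator on `ℓ²(α)`. -/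
def partialShift {α : Type*} (f : α → Option α) :
    lp (fun _ : α => ℂ) 2 →L[ℂ] lp (fun _ : α => ℂ) 2 :=
  LinearMap.mkContinuous
    { toFun := fun g => ⟨partialShiftFun f g, memℓp_gen' (sum_partialShiftFun_le f g)⟩
      map_add' := by
        intro g g'
        ext b
        change partialShiftFun f _ b = partialShiftFun f g b + partialShiftFun f g' b
        by_cases h : ∃ a, f a = some b <;> simp [partialShiftFun, h]
      map_smul' := by
        intro c g
        ext b
        change partialShiftFun f _ b = c * partialShiftFun f g b
        by_cases h : ∃ a, f a = some b <;> simp [partialShiftFun, h] }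
    1 (by
      intro g
      rw [one_mul]
      exact lp.norm_le_of_forall_sum_le (by norm_num) (norm_nonneg g)
        (fun s => sum_partialShiftFun_le f g s))

theorem partialShift_apply {α : Type*} (f : α → Option α) (g : lp (fun _ : α => ℂ) 2) (b : α) :
    partialShift f g b = partialShiftFun f g b := rfl

open Classical in
/-- The product `w v` in the free semigroupoid (first `v`, then `w`), defined exactly when the
final vertex of `v` is the initial vertex of `w`. -/
def leftMul {V : Type*} [Quiver V] (w v : FreeSemigroupoid V) : Option (FreeSemigroupoid V) :=
  if h : v.2.1 = w.1 then some ⟨v.1, w.2.1, (v.2.2.cast rfl h).comp w.2.2⟩ else none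

theorem leftMul_inj {V : Type*} [Quiver V] (w v v' u : FreeSemigroupoid V)
    (h : leftMul w v = some u) (h' : leftMul w v' = some u) : v = v' := by
  obtain ⟨a, b, p⟩ := w
  obtain ⟨c, d, q⟩ := v
  obtain ⟨c', d', q'⟩ := v'
  by_cases hd : d = a
  · by_cases hd' : d' = a
    · subst hd
      subst hd'
      simp only [leftMul, dite_true] at h h'
      rw [← h'] at h
      have h1 := Option.some.inj h
      obtain rfl : c = c' := congrArg Sigma.fst h1
      have h2 := eq_of_heq (Sigma.mk.inj h1).2
      have h3 := eq_of_heq (Sigma.mk.inj h2).2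
      have h4 : q = q' := (Path.comp_inj_left).1 h3
      rw [h4]
    · simp [leftMul, hd'] at h'
  · simp [leftMul, hd] at h

/-- The left regular representation: `L w` is the operator with `L w ξ_v = ξ_{wv}` when `wv` is
defined, and `L w ξ_v = 0` otherwise. -/
def L {V : Type*} [Quiver V] (w : FreeSemigroupoid V) : FockSpace V →L[ℂ] FockSpace V :=
  partialShift (leftMul w)

theorem L_ξ_of_some {V : Type*} [Quiver V] {w v u : FreeSemigroupoid V}
    (h : leftMul w v = some u) : L w (ξ v) = ξ u := by
  classical
  ext b
  rw [L, partialShift_apply]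
  by_cases hb : ∃ a, leftMul w a = some b
  · obtain ⟨a, ha⟩ := hb
    rw [partialShiftFun_apply _ (leftMul_inj w) _ ha]
    by_cases hav : a = v
    · subst hav
      obtain rfl : b = u := Option.some.inj (ha.symm.trans h)
      simp [ξ]
    · have hbu : b ≠ u := by
        rintro rfl
        exact hav (leftMul_inj w _ _ _ ha h)
      simp [ξ, lp.single_apply, hav, hbu]
  · rw [partialShiftFun_of_not _ _ hb]
    have hbu : b ≠ u := by
      rintro rfl
      exact hb ⟨v, h⟩
    simp [ξ, lp.single_apply, hbu]

theorem L_ξ_of_none {V : Type*} [Quiver V] {w v : FreeSemigroupoid V}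
    (h : leftMul w v = none) : L w (ξ v) = 0 := by
  classical
  ext b
  rw [L, partialShift_apply]
  by_cases hb : ∃ a, leftMul w a = some b
  · obtain ⟨a, ha⟩ := hb
    rw [partialShiftFun_apply _ (leftMul_inj w) _ ha]
    have hav : a ≠ v := by
      rintro rfl
      rw [h] at ha
      exact absurd ha (by simp)
    simp [ξ, lp.single_apply, hav]
  · rw [partialShiftFun_of_not _ _ hb]
    simp

/-- The generators of the quiver algebra: `L_e` for the edges `e` and `L_x` for the vertices `x`. -/
def generators (V : Type*) [Quiver V] : Set (FockSpace V →L[ℂ] FockSpace V) :=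
  {T | ∃ (a b : V) (e : a ⟶ b), T = L ⟨a, b, e.toPath⟩} ∪
    {T | ∃ x : V, T = L ⟨x, x, Path.nil⟩}

/-- The quiver algebra: the norm-closed algebra generated by the `L_e` and the `L_x`. -/
def quiverAlgebra (V : Type*) [Quiver V] :
    NonUnitalSubalgebra ℂ (FockSpace V →L[ℂ] FockSpace V) :=
  (NonUnitalAlgebra.adjoin ℂ (generators V)).topologicalClosure

/-- The C*-algebra generated by an algebra `S` of elements of a C*-algebra. -/
def generatedCStar {A : Type*} [CStarAlgebra A] (S : NonUnitalSubalgebra ℂ A) :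
    NonUnitalStarSubalgebra ℂ A :=
  (NonUnitalStarAlgebra.adjoin ℂ (S : Set A)).topologicalClosure

theorem le_generatedCStar {A : Type*} [CStarAlgebra A] (S : NonUnitalSubalgebra ℂ A) {a : A}
    (ha : a ∈ S) : a ∈ generatedCStar S :=
  NonUnitalStarSubalgebra.le_topologicalClosure _ (NonUnitalStarAlgebra.subset_adjoin ℂ _ ha)

/-- There is an inclusion map of `S` into `T` which is the restriction of an injection (an
injective `*`-homomorphism, not required to preserve units) between the generated C*-algebras. -/
def EmbedsIn {A B : Type*} [CStarAlgebra A] [CStarAlgebra B]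
    (S : NonUnitalSubalgebra ℂ A) (T : NonUnitalSubalgebra ℂ B) : Prop :=
  ∃ φ : generatedCStar S →⋆ₙₐ[ℂ] generatedCStar T, Function.Injective φ ∧
    ∀ (a : A) (ha : a ∈ S), (φ ⟨a, le_generatedCStar S ha⟩ : B) ∈ T

/-- The graph with one vertex and two distinct loop edges. Its quiver algebra is the
noncommutative disc algebra `𝒜₂`. -/
abbrev TwoLoops : Type := SingleObj (Fin 2)

/-- The quiver algebra of `V` is partly free: it contains the noncommutative disc algebra `𝒜₂`,
by a map that is the restriction of an injection between the generated C*-algebras. -/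
def IsPartlyFree (V : Type*) [Quiver V] : Prop :=
  EmbedsIn (quiverAlgebra TwoLoops) (quiverAlgebra V)

/-- A cycle at `x`: a path from `x` to `x` with at least one edge, such that only its initial edge
has source `x`. -/
def IsCycle {V : Type*} [Quiver V] {x : V} (w : Path x x) : Prop :=
  0 < w.length ∧
    ∀ (b c : V) (p : Path x b) (e : b ⟶ c) (q : Path c x),
      w = (p.cons e).comp q → b = x → p.length = 0

/-- The double-cycle property: there are two distinct cycles at some vertex. -/
def HasDoubleCycle (V : Type*) [Quiver V] : Prop :=
  ∃ (x : V) (w₁ w₂ : Path x x), IsCycle w₁ ∧ IsCycle w₂ ∧ w₁ ≠ w₂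

/-- Partial isometries on a Hilbert space. -/
def IsPartialIsometry {H : Type*} [NormedAddCommGroup H] [InnerProductSpace ℂ H]
    [CompleteSpace H] (U : H →L[ℂ] H) : Prop :=
  U * star U * U = U

end QuiverAlgebra

end

namespace QuiverAlgebra

/-! ### Combinatorics of closed paths at a vertex. -/

section Paths

variable {V : Type*} [Quiver V]

/-! `L` extends a path at its end, and `R`, the right regular representation, extends it at its
beginning.

From a double-cycle to a partly free algebra: cycles at `x` are indecomposable closed paths, so two
distinct ones `w 0`, `w 1` are never suffixes of one another. Hence a path ending at `x` factors
uniquely as an irreducible path followed by a word in the `w i`. This identifies ℓ² of those paths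
with ℓ²(`Irred w`) ⊗ ℓ²(words), and `T ↦ (1 ⊗ T) ⊕ 0` is an injective `*`-homomorphism carrying each
loop shift to the corresponding `L_{w i}` (`amplHom_partialShift`).

From there to the partial isometries: the images of the two loop shifts satisfy all the relations,
which are algebraic.

Back to a double-cycle: let `P` be the common initial projection of `U` and `W`. It commutes with
every `R w` (`commute_star_mul_self_of_commute`), so each vacuum vector is fixed or killed by `P`
(`projection_vac`). The set X of vertices with fixed vacuum is nonempty since `P ≠ 0`. It is finite
since an element of the norm-closed algebra tends to zero on vacuum vectors (`tendsto_vac_of_mem`),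
whereas `U` is isometric on those over X. Take `x` in X maximal for reachability, and let D(n) be
the set of paths of length less than n from `x` into X. Any endpoint leads back to `x`, so without a
double-cycle there is at most one such path of each length, and |D(n)| ≤ n. But the images of the `ξ
w`, w in D(n), under `U` and `W` form an orthonormal family of 2|D(n)| vectors, each with at least
3/4 of its mass on D(n + m) for a fixed m. Bessel's inequality gives (3/2)|D(n)| ≤ |D(n + m)|:
exponential growth, a contradiction. -/

theorem IsCycle.length_eq_zero_or {x : V} {w : Quiver.Path x x} (hw : IsCycle w)
    {p q : Quiver.Path x x} (h : w = p.comp q) : p.length = 0 ∨ q.length = 0 := by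
  by_cases hq : q.length = 0
  · exact Or.inr hq
  · obtain ⟨c, e, q', rfl, -⟩ := (Quiver.Path.length_ne_zero_iff_eq_comp q).1 hq
    refine Or.inl (hw.2 x c p e q' ?_ rfl)
    rw [h, ← Quiver.Path.comp_assoc, Quiver.Path.comp_toPath_eq_cons]

/-- With the previous lemma: cycles are the nontrivial closed paths that are indecomposable among
closed paths at `x`. -/
theorem isCycle_of_forall_comp {x : V} {w : Quiver.Path x x} (hw : 0 < w.length)
    (h : ∀ p q : Quiver.Path x x, w = p.comp q → p.length = 0 ∨ q.length = 0) : IsCycle w := by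
  refine ⟨hw, ?_⟩
  rintro b c p e q rfl rfl
  refine (h p (e.toPath.comp q) ?_).resolve_right ?_
  · rw [← Quiver.Path.comp_assoc, Quiver.Path.comp_toPath_eq_cons]
  · simp [Quiver.Path.length_comp]

/-- Levi's lemma for paths: of two suffixes of one path, the shorter is a suffix of the longer. -/
theorem exists_of_comp_eq_comp {a b c d : V} {p : Quiver.Path a b} {q : Quiver.Path a c}
    {r : Quiver.Path b d} {s : Quiver.Path c d} (h : p.comp r = q.comp s)
    (hl : r.length ≤ s.length) : ∃ t : Quiver.Path c b, s = t.comp r ∧ p = q.comp t := by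
  induction r with
  | nil => exact ⟨s, rfl, h⟩
  | cons r e ih =>
    cases s with
    | nil => simp at hl
    | cons s f =>
      simp only [Quiver.Path.comp_cons] at h
      obtain rfl := Quiver.Path.obj_eq_of_cons_eq_cons h
      have h1 := eq_of_heq (Quiver.Path.heq_of_cons_eq_cons h)
      obtain rfl := eq_of_heq (Quiver.Path.hom_heq_of_cons_eq_cons h)
      obtain ⟨t, rfl, rfl⟩ := ih h1 (by simpa using hl)
      exact ⟨t, rfl, rfl⟩

theorem exists_eq_of_comp_eq_comp {a b c d : V} {p : Quiver.Path a b} {q : Quiver.Path a c}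
    {r : Quiver.Path b d} {s : Quiver.Path c d} (h : p.comp r = q.comp s)
    (hl : p.length = q.length) :
    (⟨a, b, p⟩ : FreeSemigroupoid V) = ⟨a, c, q⟩ := by
  have h1 := congrArg Quiver.Path.length h
  rw [Quiver.Path.length_comp, Quiver.Path.length_comp] at h1
  obtain ⟨t, -, rfl⟩ := exists_of_comp_eq_comp h (by omega)
  rw [Quiver.Path.length_comp] at hl
  obtain rfl := t.eq_of_length_zero (by omega)
  rw [t.eq_nil_of_length_zero (by omega), Quiver.Path.comp_nil]

/-- Distinct cycles at a vertex are not suffixes of each other. -/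
theorem IsCycle.eq_of_comp_eq_comp {a x : V} {w w' : Quiver.Path x x} (hw : IsCycle w)
    (hw' : IsCycle w') {p q : Quiver.Path a x} (h : p.comp w = q.comp w') : w = w' := by
  wlog hl : w.length ≤ w'.length generalizing w w' p q
  · exact (this hw' hw h.symm (le_of_not_ge hl)).symm
  -- Here `t` is a closed path at `x`, and indecomposability of `w'` forces it to be trivial.
  obtain ⟨t, ht, -⟩ := exists_of_comp_eq_comp h hl
  have h0 := (hw'.length_eq_zero_or ht).resolve_right hw.1.ne'
  rw [ht, t.eq_nil_of_length_zero h0, Quiver.Path.nil_comp]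

/-- The powers of a closed path. -/
def pathPow {x : V} (c : Quiver.Path x x) : ℕ → Quiver.Path x x
  | 0 => .nil
  | n + 1 => (pathPow c n).comp c

theorem pathPow_add {x : V} (c : Quiver.Path x x) (m n : ℕ) :
    pathPow c (m + n) = (pathPow c m).comp (pathPow c n) := by
  induction n with
  | zero => rfl
  | succ n ih => rw [← Nat.add_assoc, pathPow, pathPow, ih, Quiver.Path.comp_assoc]

/-- Every closed path splits into cycles, and only `c` is available as a factor. -/
theorem exists_eq_pathPow {x : V} {c : Quiver.Path x x}
    (hc : ∀ w : Quiver.Path x x, IsCycle w → w = c) (w : Quiver.Path x x) :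
    ∃ n, w = pathPow c n := by
  induction hn : w.length using Nat.strong_induction_on generalizing w with
  | _ n ih =>
    subst hn
    by_cases h0 : w.length = 0
    · exact ⟨0, w.eq_nil_of_length_zero h0⟩
    by_cases hw : IsCycle w
    · exact ⟨1, by rw [hc w hw]; simp [pathPow]⟩
    · have : ¬ ∀ p q : Quiver.Path x x, w = p.comp q → p.length = 0 ∨ q.length = 0 :=
        fun h => hw (isCycle_of_forall_comp (Nat.pos_of_ne_zero h0) h)
      push Not at this
      obtain ⟨p, q, rfl, hp, hq⟩ := this
      rw [Quiver.Path.length_comp] at ih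
      obtain ⟨m, rfl⟩ := ih _ (by omega) p rfl
      obtain ⟨k, rfl⟩ := ih _ (by omega) q rfl
      exact ⟨m + k, (pathPow_add c m k).symm⟩

/-- Without double cycles, two paths of the same length from `x` to vertices from which `x` can be
reached are equal. -/
theorem eq_of_not_hasDoubleCycle (hV : ¬ HasDoubleCycle V) {x y z : V} (p : Quiver.Path x y)
    (q : Quiver.Path x z) (r : Quiver.Path y x) (s : Quiver.Path z x)
    (hl : p.length = q.length) : (⟨x, y, p⟩ : FreeSemigroupoid V) = ⟨x, z, q⟩ := by
  have hc : ∃ c : Quiver.Path x x, ∀ w : Quiver.Path x x, IsCycle w → w = c := by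
    by_cases h : ∃ c : Quiver.Path x x, IsCycle c
    · obtain ⟨c, hc⟩ := h
      refine ⟨c, fun w hw => ?_⟩
      by_contra hne
      exact hV ⟨x, w, c, hw, hc, hne⟩
    -- With no cycle at `x` the condition on `c` is vacuous, so any closed path serves.
    · exact ⟨.nil, fun w hw => (h ⟨w, hw⟩).elim⟩
  obtain ⟨c, hc⟩ := hc
  obtain ⟨m, hm⟩ := exists_eq_pathPow hc (p.comp r)
  obtain ⟨n, hn⟩ := exists_eq_pathPow hc (q.comp s)
  -- Powers of `c` commute, so `p` and `q` are prefixes of the same path, the power of exponent `m +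
  -- n`.
  refine exists_eq_of_comp_eq_comp (r := r.comp (pathPow c n)) (s := s.comp (pathPow c m)) ?_ hl
  rw [← Quiver.Path.comp_assoc, ← Quiver.Path.comp_assoc, hm, hn, ← pathPow_add, ← pathPow_add,
    Nat.add_comm]

end Paths

/-! ### Unique factorization of paths ending at `x`. -/

section Words

variable {V : Type*} [Quiver V] {x : V}

/-- The path obtained from a word by substituting closed paths at `x` for the letters. -/
def wordPath (w : Fin 2 → Quiver.Path x x) {a : TwoLoops} :
    ∀ {b : TwoLoops}, Quiver.Path a b → Quiver.Path x x
  | _, .nil => .nil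
  | _, .cons p e => (wordPath w p).comp (w e)

theorem wordPath_comp (w : Fin 2 → Quiver.Path x x) {a b c : TwoLoops} (p : Quiver.Path a b)
    (q : Quiver.Path b c) : wordPath w (p.comp q) = (wordPath w p).comp (wordPath w q) := by
  induction q with
  | nil => rfl
  | cons q e ih => rw [Quiver.Path.comp_cons, wordPath, wordPath, ih, Quiver.Path.comp_assoc]

/-- The paths ending at `x` which do not end with one of the closed paths `w i`. -/
abbrev Irred (w : Fin 2 → Quiver.Path x x) : Type _ :=
  {v : Σ a : V, Quiver.Path a x // ∀ i (p : Quiver.Path v.1 x), v.2 ≠ p.comp (w i)}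

/-- The path which is an irreducible path followed by a word in the closed paths `w i`. -/
def wordDecomp (w : Fin 2 → Quiver.Path x x) (v : Irred w × FreeSemigroupoid TwoLoops) :
    FreeSemigroupoid V :=
  ⟨v.1.1.1, x, v.1.1.2.comp (wordPath w v.2.2.2)⟩

/-- The last letters agree because distinct cycles are not suffixes of one another; cancel them and
recurse. Irreducibility excludes that one word runs out before the other. -/
theorem eq_of_comp_wordPath_eq {w : Fin 2 → Quiver.Path x x} (hw : ∀ i, IsCycle (w i))
    (hne : Function.Injective w) {s : TwoLoops} {a : V} {v v' : Quiver.Path a x}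
    (hv : ∀ i (p : Quiver.Path a x), v ≠ p.comp (w i))
    (hv' : ∀ i (p : Quiver.Path a x), v' ≠ p.comp (w i)) {b b' : TwoLoops}
    (p : Quiver.Path s b) (p' : Quiver.Path s b')
    (h : v.comp (wordPath w p) = v'.comp (wordPath w p')) : v = v' ∧ HEq p p' := by
  induction p generalizing b' with
  | nil =>
    cases p' with
    | nil => exact ⟨h, HEq.rfl⟩
    | cons p' e =>
      rw [wordPath, wordPath, Quiver.Path.comp_nil, ← Quiver.Path.comp_assoc] at h
      exact (hv _ _ h).elim
  | @cons b c p e ih =>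
    cases p' with
    | nil =>
      rw [wordPath, wordPath, Quiver.Path.comp_nil, ← Quiver.Path.comp_assoc] at h
      exact (hv' _ _ h.symm).elim
    | @cons d d' p' e' =>
      rw [wordPath, wordPath, ← Quiver.Path.comp_assoc, ← Quiver.Path.comp_assoc] at h
      have he : e = e' := hne ((hw e).eq_of_comp_eq_comp (hw e') h)
      rw [he] at h
      obtain ⟨h1, h2⟩ := ih p' (Quiver.Path.comp_inj_left.1 h)
      obtain rfl : b = d := Subsingleton.elim (α := Unit) _ _
      obtain rfl : c = b' := Subsingleton.elim (α := Unit) _ _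
      obtain rfl := eq_of_heq h2
      exact ⟨h1, heq_of_eq (congrArg (Quiver.Path.cons p) he)⟩

theorem wordDecomp_injective {w : Fin 2 → Quiver.Path x x} (hw : ∀ i, IsCycle (w i))
    (hne : Function.Injective w) : Function.Injective (wordDecomp w) := by
  rintro ⟨⟨⟨a, v⟩, hv⟩, ⟨s, t, p⟩⟩ ⟨⟨⟨a', v'⟩, hv'⟩, ⟨s', t', p'⟩⟩ h
  obtain rfl : s = s' := Subsingleton.elim (α := Unit) _ _
  obtain rfl : t = t' := Subsingleton.elim (α := Unit) _ _
  simp only [wordDecomp] at h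
  obtain rfl : a = a' := congrArg Sigma.fst h
  have h1 := eq_of_heq (Sigma.mk.inj (eq_of_heq (Sigma.mk.inj h).2)).2
  obtain ⟨rfl, h2⟩ := eq_of_comp_wordPath_eq hw hne hv hv' p p' h1
  rw [eq_of_heq h2]

/-- Strip final factors `w i` until none is left; positive length ensures termination. -/
theorem exists_wordDecomp_eq {w : Fin 2 → Quiver.Path x x} (hw : ∀ i, 0 < (w i).length) {a : V}
    (p : Quiver.Path a x) : ∃ v, wordDecomp w v = ⟨a, x, p⟩ := by
  induction hn : p.length using Nat.strong_induction_on generalizing p with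
  | _ n ih =>
    subst hn
    by_cases h : ∃ i, ∃ q : Quiver.Path a x, p = q.comp (w i)
    · obtain ⟨i, q, rfl⟩ := h
      have := hw i
      rw [Quiver.Path.length_comp] at ih
      obtain ⟨⟨v, ⟨b, c, u⟩⟩, hv⟩ := ih _ (by omega) q rfl
      refine ⟨⟨v, ⟨b, c, u.cons (i : c ⟶ c)⟩⟩, ?_⟩
      obtain ⟨⟨a', v⟩, hv'⟩ := v
      simp only [wordDecomp] at hv ⊢
      obtain rfl : a' = a := congrArg Sigma.fst hv
      have h1 := eq_of_heq (Sigma.mk.inj (eq_of_heq (Sigma.mk.inj hv).2)).2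
      rw [wordPath, ← Quiver.Path.comp_assoc, h1]
    · push Not at h
      exact ⟨⟨⟨⟨a, p⟩, h⟩, ⟨PUnit.unit, PUnit.unit, .nil⟩⟩, rfl⟩

end Words

/-! ### Amplifications on ℓ² spaces. -/

section SequenceSpaces

variable {α β ι : Type*}

theorem hasSum_norm_sq (g : lp (fun _ : α => ℂ) 2) :
    HasSum (fun a => ‖g a‖ ^ 2) (‖g‖ ^ 2) := by
  have h := lp.hasSum_norm (p := 2) (by norm_num) g
  simpa using h

/-- A bounded operator into `ℓ²(β)`, from the coordinates of its values. -/
noncomputable def lpCLM (F : lp (fun _ : α => ℂ) 2 →ₗ[ℂ] (β → ℂ)) (C : ℝ) (hC : 0 ≤ C)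
    (hF : ∀ g (s : Finset β), ∑ b ∈ s, ‖F g b‖ ^ 2 ≤ (C * ‖g‖) ^ 2) :
    lp (fun _ : α => ℂ) 2 →L[ℂ] lp (fun _ : β => ℂ) 2 :=
  LinearMap.mkContinuous
    { toFun := fun g => ⟨F g, memℓp_gen' (C := (C * ‖g‖) ^ 2) fun s => by simpa using hF g s⟩
      map_add' := fun g g' => by
        ext b
        exact congrFun (F.map_add g g') b
      map_smul' := fun c g => by
        ext b
        exact congrFun (F.map_smul c g) b }
    C fun g => lp.norm_le_of_forall_sum_le (by norm_num) (by positivity)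
      fun s => by simpa using hF g s

/-- Composition with an injective map of the index sets. -/
noncomputable def comapCLM (J : α → β) (hJ : Function.Injective J) :
    lp (fun _ : β => ℂ) 2 →L[ℂ] lp (fun _ : α => ℂ) 2 :=
  lpCLM
    { toFun := fun g a => g (J a)
      map_add' := fun _ _ => rfl
      map_smul' := fun _ _ => rfl } 1 zero_le_one fun g s => by
    classical
    rw [one_mul]
    change ∑ a ∈ s, ‖g (J a)‖ ^ 2 ≤ ‖g‖ ^ 2
    rw [← Finset.sum_image (f := fun b => ‖g b‖ ^ 2) hJ.injOn]
    exact sum_le_hasSum _ (fun _ _ => by positivity) (hasSum_norm_sq g)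

theorem comapCLM_apply (J : α → β) (hJ : Function.Injective J) (g : lp (fun _ : β => ℂ) 2)
    (a : α) : comapCLM J hJ g a = g (J a) := rfl

theorem adjoint_comapCLM_apply (J : α → β) (hJ : Function.Injective J)
    (g : lp (fun _ : α => ℂ) 2) (a : α) :
    (comapCLM J hJ).adjoint g (J a) = g a := by
  classical
  have h := ContinuousLinearMap.adjoint_inner_right (comapCLM J hJ)
    (lp.single 2 (J a) (1 : ℂ)) g
  have h1 : comapCLM J hJ (lp.single 2 (J a) (1 : ℂ)) = lp.single 2 a (1 : ℂ) := by
    ext a'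
    rw [comapCLM_apply]
    by_cases ha : a' = a
    · subst ha
      simp
    · simp [lp.single_apply, ha, hJ.ne ha]
  rw [h1] at h
  simpa [lp.inner_single_left] using h

theorem adjoint_comapCLM_apply_of_notMem (J : α → β) (hJ : Function.Injective J)
    (g : lp (fun _ : α => ℂ) 2) {b : β} (hb : ∀ a, J a ≠ b) :
    (comapCLM J hJ).adjoint g b = 0 := by
  classical
  have h := ContinuousLinearMap.adjoint_inner_right (comapCLM J hJ) (lp.single 2 b (1 : ℂ)) g
  have h1 : comapCLM J hJ (lp.single 2 b (1 : ℂ)) = 0 := by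
    ext a'
    rw [comapCLM_apply]
    simp [lp.single_apply, hb a']
  rw [h1] at h
  simpa [lp.inner_single_left] using h

/-- The adjoint of `comapCLM` is extension by zero, an isometry. This identity makes `amplHom`
multiplicative. -/
theorem comapCLM_comp_adjoint (J : α → β) (hJ : Function.Injective J) :
    comapCLM J hJ ∘L (comapCLM J hJ).adjoint = ContinuousLinearMap.id ℂ _ := by
  ext g a
  exact adjoint_comapCLM_apply J hJ g a

theorem mk_right_injective (i : ι) : Function.Injective (fun a : α => (i, a)) :=
  fun _ _ h => (Prod.mk.inj h).2

/-- The restriction of an element of `ℓ²(ι × α)` to the fibre over `i`. -/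
noncomputable def slice (i : ι) : lp (fun _ : ι × α => ℂ) 2 →L[ℂ] lp (fun _ : α => ℂ) 2 :=
  comapCLM (fun a => (i, a)) (mk_right_injective i)

theorem hasSum_norm_slice_sq (g : lp (fun _ : ι × α => ℂ) 2) :
    HasSum (fun i => ‖slice i g‖ ^ 2) (‖g‖ ^ 2) :=
  (hasSum_norm_sq g).prod_fiberwise fun i => hasSum_norm_sq (slice i g)

theorem hasSum_inner_slice (f g : lp (fun _ : ι × α => ℂ) 2) :
    HasSum (fun i => inner ℂ (slice i f) (slice i g)) (inner ℂ f g) :=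
  (lp.hasSum_inner f g).prod_fiberwise fun i => lp.hasSum_inner (slice i f) (slice i g)

/-- The operator `1 ⊗ T` on `ℓ²(ι × α)`. -/
noncomputable def ampl (ι : Type*) (T : lp (fun _ : α => ℂ) 2 →L[ℂ] lp (fun _ : α => ℂ) 2) :
    lp (fun _ : ι × α => ℂ) 2 →L[ℂ] lp (fun _ : ι × α => ℂ) 2 :=
  lpCLM
    { toFun := fun g p => T (slice p.1 g) p.2
      map_add' := fun g g' => by
        ext p
        simp
      map_smul' := fun c g => by
        ext p
        simp } ‖T‖ (norm_nonneg T) fun g s => by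
    classical
    change ∑ p ∈ s, ‖T (slice p.1 g) p.2‖ ^ 2 ≤ _
    calc ∑ p ∈ s, ‖T (slice p.1 g) p.2‖ ^ 2
        ≤ ∑ p ∈ s.image Prod.fst ×ˢ s.image Prod.snd, ‖T (slice p.1 g) p.2‖ ^ 2 :=
          Finset.sum_le_sum_of_subset_of_nonneg Finset.subset_product
            (fun _ _ _ => by positivity)
      _ = ∑ i ∈ s.image Prod.fst, ∑ a ∈ s.image Prod.snd, ‖T (slice i g) a‖ ^ 2 :=
          Finset.sum_product _ _ _
      _ ≤ ∑ i ∈ s.image Prod.fst, ‖T‖ ^ 2 * ‖slice i g‖ ^ 2 := by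
          refine Finset.sum_le_sum fun i _ => ?_
          calc ∑ a ∈ s.image Prod.snd, ‖T (slice i g) a‖ ^ 2 ≤ ‖T (slice i g)‖ ^ 2 :=
                sum_le_hasSum _ (fun _ _ => by positivity) (hasSum_norm_sq _)
            _ ≤ (‖T‖ * ‖slice i g‖) ^ 2 := by
                gcongr
                exact T.le_opNorm _
            _ = _ := mul_pow _ _ _
      _ ≤ ‖T‖ ^ 2 * ‖g‖ ^ 2 := by
          rw [← Finset.mul_sum]
          gcongr
          exact sum_le_hasSum _ (fun _ _ => by positivity) (hasSum_norm_slice_sq g)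
      _ = (‖T‖ * ‖g‖) ^ 2 := (mul_pow _ _ _).symm

variable (T S : lp (fun _ : α => ℂ) 2 →L[ℂ] lp (fun _ : α => ℂ) 2)

theorem slice_ampl (i : ι) (g : lp (fun _ : ι × α => ℂ) 2) :
    slice i (ampl ι T g) = T (slice i g) := rfl

theorem ampl_mul : ampl ι (T * S) = ampl ι T * ampl ι S := by
  ext g p
  rfl

theorem ampl_star : ampl ι (star T) = star (ampl ι T) := by
  rw [ContinuousLinearMap.star_eq_adjoint, ContinuousLinearMap.star_eq_adjoint,
    ContinuousLinearMap.eq_adjoint_iff]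
  intro f g
  have h1 := hasSum_inner_slice (ampl ι T.adjoint f) g
  have h2 := hasSum_inner_slice f (ampl ι T g)
  refine h1.unique ?_
  convert h2 using 2 with i
  rw [slice_ampl, slice_ampl, ContinuousLinearMap.adjoint_inner_left]

/-- The `*`-homomorphism `T ↦ (1 ⊗ T) ⊕ 0` given by an injection of `ι × α` into `β`. -/
noncomputable def amplHom (J : ι × α → β) (hJ : Function.Injective J) :
    (lp (fun _ : α => ℂ) 2 →L[ℂ] lp (fun _ : α => ℂ) 2) →⋆ₙₐ[ℂ]
      (lp (fun _ : β => ℂ) 2 →L[ℂ] lp (fun _ : β => ℂ) 2) where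
  toFun T := (comapCLM J hJ).adjoint ∘L ampl ι T ∘L comapCLM J hJ
  map_smul' c T := by
    have : ampl ι (c • T) = c • ampl ι T := by
      ext g p
      rfl
    simp [this]
  map_zero' := by
    have : ampl ι (0 : lp (fun _ : α => ℂ) 2 →L[ℂ] lp (fun _ : α => ℂ) 2) = 0 := by
      ext g p
      rfl
    simp [this]
  map_add' T S := by
    have : ampl ι (T + S) = ampl ι T + ampl ι S := by
      ext g p
      rfl
    simp [this]
  map_mul' T S := by
    have h : ∀ g, comapCLM J hJ ((comapCLM J hJ).adjoint g) = g :=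
      fun g => DFunLike.congr_fun (comapCLM_comp_adjoint J hJ) g
    ext1 g
    simp [ampl_mul, h]
  map_star' T := by
    rw [ampl_star, ContinuousLinearMap.star_eq_adjoint, ContinuousLinearMap.star_eq_adjoint,
      ContinuousLinearMap.adjoint_comp, ContinuousLinearMap.adjoint_comp,
      ContinuousLinearMap.adjoint_adjoint, ContinuousLinearMap.comp_assoc]

theorem amplHom_apply (J : ι × α → β) (hJ : Function.Injective J)
    (g : lp (fun _ : β => ℂ) 2) (i : ι) (a : α) :
    amplHom J hJ T g (J (i, a)) = T (slice i (comapCLM J hJ g)) a :=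
  adjoint_comapCLM_apply J hJ _ (i, a)

theorem amplHom_apply_of_notMem (J : ι × α → β) (hJ : Function.Injective J)
    (g : lp (fun _ : β => ℂ) 2) {b : β} (hb : ∀ p, J p ≠ b) : amplHom J hJ T g b = 0 :=
  adjoint_comapCLM_apply_of_notMem J hJ _ hb

theorem amplHom_injective [Nonempty ι] (J : ι × α → β) (hJ : Function.Injective J) :
    Function.Injective (amplHom J hJ) := by
  intro T S h
  obtain ⟨i⟩ := ‹Nonempty ι›
  ext g a
  have h1 : slice i (comapCLM J hJ ((comapCLM J hJ).adjoint ((slice i).adjoint g))) = g := by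
    ext a
    exact (adjoint_comapCLM_apply J hJ _ (i, a)).trans
      (adjoint_comapCLM_apply (fun a => (i, a)) (mk_right_injective i) g a)
  rw [← h1, ← amplHom_apply T J hJ, ← amplHom_apply S J hJ, h]

/-- `J` carries `f` on every fibre to `F`, and `F` is undefined everywhere else, in particular off
the range of `J`. -/
theorem amplHom_partialShift (J : ι × α → β) (hJ : Function.Injective J) {f : α → Option α}
    {F : β → Option β} (hf : ∀ a a' b, f a = some b → f a' = some b → a = a')
    (hF : ∀ a a' b, F a = some b → F a' = some b → a = a')
    (hfF : ∀ i a a', f a = some a' → F (J (i, a)) = some (J (i, a')))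
    (hFf : ∀ b b', F b = some b' → ∃ i a a', b = J (i, a) ∧ f a = some a') :
    amplHom J hJ (partialShift f) = partialShift F := by
  ext g b
  rw [partialShift_apply]
  by_cases h : ∃ b', F b' = some b
  · obtain ⟨b', hb'⟩ := h
    obtain ⟨i, a, a', rfl, ha⟩ := hFf _ _ hb'
    obtain rfl := Option.some.inj ((hfF i a a' ha).symm.trans hb')
    rw [partialShiftFun_apply F hF _ hb', amplHom_apply, partialShift_apply,
      partialShiftFun_apply f hf _ ha]
    rfl
  · rw [partialShiftFun_of_not F _ h]
    by_cases hb : ∃ p, J p = b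
    · obtain ⟨⟨i, a⟩, rfl⟩ := hb
      rw [amplHom_apply, partialShift_apply, partialShiftFun_of_not]
      rintro ⟨a', ha'⟩
      exact h ⟨_, hfF i _ _ ha'⟩
    · push Not at hb
      exact amplHom_apply_of_notMem _ J hJ g hb

end SequenceSpaces

/-! ### Adjoints of partial shifts. -/

section PartialShift

variable {α : Type*} {f : α → Option α}

theorem partialShift_single_of_some [DecidableEq α]
    (hf : ∀ a a' b, f a = some b → f a' = some b → a = a') {a b : α} (h : f a = some b) :
    partialShift f (lp.single 2 a (1 : ℂ)) = lp.single 2 b (1 : ℂ) := by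
  ext c
  rw [partialShift_apply]
  by_cases hc : ∃ a, f a = some c
  · obtain ⟨a', ha'⟩ := hc
    rw [partialShiftFun_apply f hf _ ha']
    by_cases haa : a' = a
    · subst haa
      obtain rfl := Option.some.inj (ha'.symm.trans h)
      simp
    · have hcb : c ≠ b := by
        rintro rfl
        exact haa (hf _ _ _ ha' h)
      simp [lp.single_apply, haa, hcb]
  · rw [partialShiftFun_of_not f _ hc]
    have hcb : c ≠ b := by
      rintro rfl
      exact hc ⟨a, h⟩
    simp [lp.single_apply, hcb]

theorem partialShift_single_of_none [DecidableEq α]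
    (hf : ∀ a a' b, f a = some b → f a' = some b → a = a') {a : α} (h : f a = none) :
    partialShift f (lp.single 2 a (1 : ℂ)) = 0 := by
  ext c
  rw [partialShift_apply]
  by_cases hc : ∃ a, f a = some c
  · obtain ⟨a', ha'⟩ := hc
    rw [partialShiftFun_apply f hf _ ha']
    have haa : a' ≠ a := by
      rintro rfl
      simp [h] at ha'
    simp [lp.single_apply, haa]
  · rw [partialShiftFun_of_not f _ hc]
    simp

theorem star_partialShift_apply_of_some
    (hf : ∀ a a' b, f a = some b → f a' = some b → a = a') (g : lp (fun _ : α => ℂ) 2) {a b : α}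
    (h : f a = some b) : star (partialShift f) g a = g b := by
  classical
  have h1 := ContinuousLinearMap.adjoint_inner_right (partialShift f) (lp.single 2 a (1 : ℂ)) g
  rw [partialShift_single_of_some hf h] at h1
  simpa [lp.inner_single_left, ContinuousLinearMap.star_eq_adjoint] using h1

theorem star_partialShift_apply_of_none
    (hf : ∀ a a' b, f a = some b → f a' = some b → a = a') (g : lp (fun _ : α => ℂ) 2) {a : α}
    (h : f a = none) : star (partialShift f) g a = 0 := by
  classical
  have h1 := ContinuousLinearMap.adjoint_inner_right (partialShift f) (lp.single 2 a (1 : ℂ)) g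
  rw [partialShift_single_of_none hf h] at h1
  simpa [lp.inner_single_left, ContinuousLinearMap.star_eq_adjoint] using h1

theorem star_partialShift_mul_self (hf : ∀ a a' b, f a = some b → f a' = some b → a = a') :
    star (partialShift f) * partialShift f = partialShift fun a => (f a).map fun _ => a := by
  ext g a
  rw [mul_apply_eq_comp, partialShift_apply]
  rcases h : f a with _ | b
  · rw [star_partialShift_apply_of_none hf _ h, partialShiftFun_of_not]
    rintro ⟨a', ha'⟩
    obtain ⟨b, hb, rfl⟩ := Option.map_eq_some_iff.1 ha'
    simp [h] at hb
  · rw [star_partialShift_apply_of_some hf _ h, partialShift_apply, partialShiftFun_apply f hf _ h,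
      partialShiftFun_apply _ _ _ (a := a)]
    · simp [h]
    · intro a a' c ha ha'
      obtain ⟨_, -, rfl⟩ := Option.map_eq_some_iff.1 ha
      obtain ⟨_, -, h2⟩ := Option.map_eq_some_iff.1 ha'
      exact h2.symm

theorem star_partialShift_mul_of_disjoint {f' : α → Option α}
    (hf : ∀ a a' b, f a = some b → f a' = some b → a = a')
    (h : ∀ a a' b, f a = some b → f' a' = some b → False) :
    star (partialShift f) * partialShift f' = 0 := by
  ext g a
  rw [mul_apply_eq_comp]
  rcases ha : f a with _ | b
  · exact star_partialShift_apply_of_none hf _ ha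
  · rw [star_partialShift_apply_of_some hf _ ha, partialShift_apply, partialShiftFun_of_not]
    · rfl
    · rintro ⟨a', ha'⟩
      exact h _ _ _ ha ha'

end PartialShift

/-! ### Path operators and their products. -/

section Generators

variable {V : Type*} [Quiver V]

theorem leftMul_comp {a b c : V} (p : Quiver.Path a b) (q : Quiver.Path b c) :
    leftMul ⟨b, c, q⟩ ⟨a, b, p⟩ = some ⟨a, c, p.comp q⟩ := by
  simp [leftMul]

theorem leftMul_eq_some_iff {w v u : FreeSemigroupoid V} :
    leftMul w v = some u ↔ ∃ (a b c : V) (p : Quiver.Path a b) (q : Quiver.Path b c),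
      w = ⟨b, c, q⟩ ∧ v = ⟨a, b, p⟩ ∧ u = ⟨a, c, p.comp q⟩ := by
  constructor
  · intro h
    obtain ⟨a, b, p⟩ := v
    obtain ⟨b', c, q⟩ := w
    by_cases hb : b = b'
    · subst hb
      rw [leftMul_comp] at h
      exact ⟨a, b, c, p, q, rfl, rfl, (Option.some.inj h).symm⟩
    · simp [leftMul, hb] at h
  · rintro ⟨a, b, c, p, q, rfl, rfl, rfl⟩
    exact leftMul_comp p q

theorem L_ξ_comp {a b c : V} (p : Quiver.Path a b) (q : Quiver.Path b c) :
    L ⟨b, c, q⟩ (ξ ⟨a, b, p⟩) = ξ ⟨a, c, p.comp q⟩ :=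
  L_ξ_of_some (leftMul_comp p q)

theorem L_ξ_of_ne {a b b' c : V} (p : Quiver.Path a b) (q : Quiver.Path b' c) (h : b ≠ b') :
    L ⟨b', c, q⟩ (ξ ⟨a, b, p⟩) = 0 :=
  L_ξ_of_none (by simp [leftMul, h])

theorem clm_ext_ξ {E : Type*} [NormedAddCommGroup E] [NormedSpace ℂ E]
    {T S : FockSpace V →L[ℂ] E} (h : ∀ w, T (ξ w) = S (ξ w)) : T = S := by
  classical
  ext1 g
  have hg := lp.hasSum_single (p := 2) (by norm_num) g
  refine (hg.mapL T).unique ?_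
  convert hg.mapL S using 2 with w
  have hw : lp.single 2 w (g w) = g w • (ξ w : FockSpace V) := by
    rw [ξ, ← lp.single_smul, smul_eq_mul, mul_one]
  rw [hw, map_smul, map_smul, h]

theorem L_mul_L {a b c : V} (p : Quiver.Path a b) (q : Quiver.Path b c) :
    L ⟨b, c, q⟩ * L ⟨a, b, p⟩ = L ⟨a, c, p.comp q⟩ := by
  refine clm_ext_ξ ?_
  rintro ⟨d, e, r⟩
  rw [mul_apply_eq_comp]
  by_cases h : e = a
  · subst h
    rw [L_ξ_comp, L_ξ_comp, L_ξ_comp, Quiver.Path.comp_assoc]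
  · rw [L_ξ_of_ne _ _ h, L_ξ_of_ne _ _ h, map_zero]

theorem L_mem_adjoin {a b : V} (p : Quiver.Path a b) :
    L ⟨a, b, p⟩ ∈ NonUnitalAlgebra.adjoin ℂ (generators V) := by
  induction p with
  | nil => exact NonUnitalAlgebra.subset_adjoin ℂ (Or.inr ⟨a, rfl⟩)
  | cons p e ih =>
    rw [← Quiver.Path.comp_toPath_eq_cons, ← L_mul_L]
    exact mul_mem (NonUnitalAlgebra.subset_adjoin ℂ (Or.inl ⟨_, _, e, rfl⟩)) ih

theorem L_mem_quiverAlgebra {a b : V} (p : Quiver.Path a b) :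
    L ⟨a, b, p⟩ ∈ quiverAlgebra V :=
  NonUnitalSubalgebra.le_topologicalClosure _ (L_mem_adjoin p)

end Generators

/-! ### A double-cycle gives a copy of the noncommutative disc algebra. -/

section PartlyFree

variable {V : Type*} [Quiver V]

/-- A `*`-homomorphism of C*-algebras is contractive, so it maps the closure of the `*`-algebra
generated by `S` into that for `T`. -/
theorem embedsIn_of_starHom {A B : Type*} [CStarAlgebra A] [CStarAlgebra B]
    {S : NonUnitalSubalgebra ℂ A} {T : NonUnitalSubalgebra ℂ B} (Φ : A →⋆ₙₐ[ℂ] B)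
    (hΦ : Function.Injective Φ) (hST : ∀ a ∈ S, Φ a ∈ T) : EmbedsIn S T := by
  have hc : Continuous Φ := AddMonoidHomClass.continuous_of_bound Φ 1 fun a => by
    rw [one_mul]
    exact NonUnitalStarAlgHom.norm_apply_le Φ a
  have hadj : ∀ a ∈ NonUnitalStarAlgebra.adjoin ℂ (S : Set A),
      Φ a ∈ NonUnitalStarAlgebra.adjoin ℂ (T : Set B) := by
    intro a ha
    have hle : NonUnitalStarAlgebra.adjoin ℂ (S : Set A) ≤
        (NonUnitalStarAlgebra.adjoin ℂ (T : Set B)).comap Φ :=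
      NonUnitalStarAlgebra.adjoin_le fun s hs =>
        NonUnitalStarAlgebra.subset_adjoin ℂ _ (hST s hs)
    exact hle ha
  have hmem : ∀ a : generatedCStar S, Φ a ∈ generatedCStar T :=
    fun a => map_mem_closure hc a.2 hadj
  refine ⟨NonUnitalStarAlgHom.codRestrict
    (Φ.comp (NonUnitalStarSubalgebraClass.subtype (generatedCStar S))) (generatedCStar T) hmem,
    ?_, fun a ha => hST a ha⟩
  intro a b hab
  exact Subtype.ext (hΦ (congrArg Subtype.val hab))

theorem HasDoubleCycle.isPartlyFree (hV : HasDoubleCycle V) : IsPartlyFree V := by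
  obtain ⟨x, w₁, w₂, hw₁, hw₂, hne⟩ := hV
  let w : Fin 2 → Quiver.Path x x := ![w₁, w₂]
  have hw : ∀ i, IsCycle (w i) := by
    intro i
    fin_cases i
    exacts [hw₁, hw₂]
  have hinj : Function.Injective w := by
    intro i j hij
    fin_cases i <;> fin_cases j <;> first | rfl | exact (hne hij).elim | exact (hne hij.symm).elim
  have hJ := wordDecomp_injective hw hinj
  have hsurj : ∀ {a : V} (p : Quiver.Path a x), ∃ v, wordDecomp w v = ⟨a, x, p⟩ :=
    exists_wordDecomp_eq fun i => (hw i).1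
  have : Nonempty (Irred w) := ⟨(hsurj .nil).choose.1⟩
  have hL : ∀ u : FreeSemigroupoid TwoLoops,
      amplHom (wordDecomp w) hJ (L u) = L ⟨x, x, wordPath w u.2.2⟩ := by
    intro u
    have hJu : ∀ i a a', leftMul u a = some a' →
        leftMul ⟨x, x, wordPath w u.2.2⟩ (wordDecomp w (i, a)) = some (wordDecomp w (i, a')) := by
      intro i a a' h
      obtain ⟨b, c, d, p, q, rfl, rfl, rfl⟩ := leftMul_eq_some_iff.1 h
      rw [wordDecomp, leftMul_comp, wordDecomp, wordPath_comp, Quiver.Path.comp_assoc]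
    refine amplHom_partialShift _ hJ (leftMul_inj u) (leftMul_inj _) hJu ?_
    -- The operator for a closed path at `x` only sees paths ending at `x`, and all of these lie in
    -- the range of `wordDecomp w`.
    intro b b' h
    obtain ⟨c, d, e, p, q, hq, rfl, rfl⟩ := leftMul_eq_some_iff.1 h
    obtain rfl : x = d := congrArg Sigma.fst hq
    obtain ⟨⟨i, s, t, r⟩, hv⟩ := hsurj p
    obtain ⟨t', t'', r'⟩ := u
    obtain rfl : t = t' := Subsingleton.elim (α := Unit) _ _
    exact ⟨i, _, _, hv.symm, leftMul_comp r r'⟩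
  refine embedsIn_of_starHom (amplHom (wordDecomp w) hJ) (amplHom_injective _ hJ) ?_
  have hadj : ∀ T ∈ NonUnitalAlgebra.adjoin ℂ (generators TwoLoops),
      amplHom (wordDecomp w) hJ T ∈ NonUnitalAlgebra.adjoin ℂ (generators V) := by
    intro T hT
    have hle : NonUnitalAlgebra.adjoin ℂ (generators TwoLoops) ≤
        (NonUnitalAlgebra.adjoin ℂ (generators V)).comap (amplHom (wordDecomp w) hJ) := by
      refine NonUnitalAlgebra.adjoin_le ?_
      rintro _ (⟨a, b, e, rfl⟩ | ⟨a, rfl⟩)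
      all_goals
        change amplHom (wordDecomp w) hJ _ ∈ NonUnitalAlgebra.adjoin ℂ (generators V)
        rw [hL]
        exact L_mem_adjoin _
    exact hle hT
  have hc : Continuous (amplHom (wordDecomp w) hJ) :=
    AddMonoidHomClass.continuous_of_bound _ 1 fun a => by
      rw [one_mul]
      exact NonUnitalStarAlgHom.norm_apply_le _ a
  exact fun T hT => map_mem_closure hc hT hadj

end PartlyFree

/-! ### Partial isometries from the loop shifts. -/

section Isometries

variable {V : Type*} [Quiver V]

theorem inner_ξ_left (w : FreeSemigroupoid V) (g : FockSpace V) : inner ℂ (ξ w) g = g w := by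
  classical
  rw [ξ]
  simpa using lp.inner_single_left (𝕜 := ℂ) w (1 : ℂ) g

theorem ξ_apply_self (w : FreeSemigroupoid V) : (ξ w : FockSpace V) w = 1 := by
  simp [ξ]

theorem ξ_apply_of_ne {w v : FreeSemigroupoid V} (h : v ≠ w) : (ξ w : FockSpace V) v = 0 := by
  simp [ξ, lp.single_apply, h]

theorem ξ_ne_zero (w : FreeSemigroupoid V) : (ξ w : FockSpace V) ≠ 0 := fun h => by
  have := ξ_apply_self w
  rw [h] at this
  simp at this

theorem star_L_mul_L (w : FreeSemigroupoid V) : star (L w) * L w = L ⟨w.1, w.1, .nil⟩ := by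
  rw [L, star_partialShift_mul_self (leftMul_inj w), L]
  congr 1
  ext1 v
  obtain ⟨b, c, q⟩ := w
  obtain ⟨a, b', p⟩ := v
  by_cases h : b' = b
  · subst h
    rw [leftMul_comp, leftMul_comp]
    rfl
  · simp [leftMul, h]

/-- The operator of the loop with label `i` in the noncommutative disc algebra. -/
noncomputable abbrev loopShift (i : Fin 2) : FockSpace TwoLoops →L[ℂ] FockSpace TwoLoops :=
  L ⟨SingleObj.star _, SingleObj.star _, Quiver.Hom.toPath (V := TwoLoops) i⟩

/-- The two ranges are spanned by words with different last letters. -/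
theorem star_loopShift_zero_mul_one : star (loopShift 0) * loopShift 1 = 0 := by
  refine star_partialShift_mul_of_disjoint (leftMul_inj _) fun u v z hu hv => ?_
  obtain ⟨a, b, c, p, q, h1, -, h3⟩ := leftMul_eq_some_iff.1 hu
  obtain ⟨a', b', c', p', q', h1', -, h3'⟩ := leftMul_eq_some_iff.1 hv
  obtain rfl : b = SingleObj.star _ := Subsingleton.elim (α := Unit) _ _
  obtain rfl : b' = SingleObj.star _ := Subsingleton.elim (α := Unit) _ _
  obtain rfl : c = SingleObj.star _ := Subsingleton.elim (α := Unit) _ _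
  obtain rfl : c' = SingleObj.star _ := Subsingleton.elim (α := Unit) _ _
  have h2 := eq_of_heq (Sigma.mk.inj (eq_of_heq (Sigma.mk.inj h1).2)).2
  have h2' := eq_of_heq (Sigma.mk.inj (eq_of_heq (Sigma.mk.inj h1').2)).2
  subst h2 h2' h3
  obtain rfl : a = a' := congrArg Sigma.fst h3'
  have h4 := eq_of_heq (Sigma.mk.inj (eq_of_heq (Sigma.mk.inj h3').2)).2
  have h5 := eq_of_heq (Quiver.Path.hom_heq_of_cons_eq_cons h4)
  exact absurd h5 (show (0 : Fin 2) ≠ 1 by decide)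

/-- The difference of the two projections is a self-adjoint idempotent, hence of the form `star D *
D`. -/
theorem mul_star_le_star_mul_of_mul_eq {A : Type*} [CStarAlgebra A] [PartialOrder A]
    [StarOrderedRing A] {U : A} (h1 : U * (star U * U) = U) (h2 : star U * U * U = U) :
    U * star U ≤ star U * U := by
  have h3 : star U * (star U * U) = star U := by
    simpa [mul_assoc] using congrArg star h2
  rw [← sub_nonneg]
  have : star U * U - U * star U = star (star U * U - U * star U) * (star U * U - U * star U) := by
    simp only [star_sub, star_mul, star_star, mul_sub, sub_mul]
    have e1 : star U * U * (star U * U) = star U * U := by rw [mul_assoc, h1]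
    have e2 : U * star U * (star U * U) = U * star U := by rw [mul_assoc, h3]
    have e3 : star U * U * (U * star U) = U * star U := by rw [← mul_assoc, h2]
    have e4 : U * star U * (U * star U) = U * star U := by
      rw [← mul_assoc, mul_assoc U, h1]
    rw [e1, e2, e3, e4]
    abel
  rw [this]
  exact star_mul_self_nonneg _

theorem exists_partialIsometries_of_starHom {C H : Type*} [NonUnitalRing C] [_root_.Star C]
    [Module ℂ C] [NormedAddCommGroup H] [InnerProductSpace ℂ H] [CompleteSpace H]
    (ψ : C →⋆ₙₐ[ℂ] (H →L[ℂ] H)) (hψ : Function.Injective ψ) {s : Fin 2 → C} {o : C}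
    (hs : ∀ i, s i ≠ 0) (hss : ∀ i, star (s i) * s i = o) (hso : ∀ i, s i * o = s i)
    (hos : ∀ i, o * s i = s i) (h01 : star (s 0) * s 1 = 0) {A : NonUnitalSubalgebra ℂ (H →L[ℂ] H)}
    (hA : ∀ i, ψ (s i) ∈ A) :
    ∃ U ∈ A, ∃ W ∈ A, U ≠ 0 ∧ W ≠ 0 ∧
      IsPartialIsometry U ∧ IsPartialIsometry W ∧ star U * U = star W * W ∧
      U * star U ≤ star U * U ∧ W * star W ≤ star W * W ∧ star U * W = 0 := by
  have h1 : ∀ i, star (ψ (s i)) * ψ (s i) = ψ o := fun i => by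
    rw [← map_star, ← map_mul, hss]
  have h2 : ∀ i, ψ (s i) * (star (ψ (s i)) * ψ (s i)) = ψ (s i) := fun i => by
    rw [h1, ← map_mul, hso]
  have h3 : ∀ i, star (ψ (s i)) * ψ (s i) * ψ (s i) = ψ (s i) := fun i => by
    rw [h1, ← map_mul, hos]
  have h4 : ∀ i, ψ (s i) ≠ 0 := fun i h => hs i (hψ (h.trans (map_zero ψ).symm))
  exact ⟨_, hA 0, _, hA 1, h4 0, h4 1, (mul_assoc _ _ _).trans (h2 0),
    (mul_assoc _ _ _).trans (h2 1), (h1 0).trans (h1 1).symm,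
    mul_star_le_star_mul_of_mul_eq (h2 0) (h3 0), mul_star_le_star_mul_of_mul_eq (h2 1) (h3 1),
    by rw [← map_star, ← map_mul, h01, map_zero]⟩

theorem IsPartlyFree.exists_partialIsometries (hV : IsPartlyFree V) :
    ∃ U ∈ quiverAlgebra V, ∃ W ∈ quiverAlgebra V, U ≠ 0 ∧ W ≠ 0 ∧
      IsPartialIsometry U ∧ IsPartialIsometry W ∧ star U * U = star W * W ∧
      U * star U ≤ star U * U ∧ W * star W ≤ star W * W ∧ star U * W = 0 := by
  obtain ⟨φ, hφ, hmem⟩ := hV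
  have hS : ∀ i, loopShift i ∈ quiverAlgebra TwoLoops := fun i => L_mem_quiverAlgebra _
  refine exists_partialIsometries_of_starHom
    ((NonUnitalStarSubalgebraClass.subtype (generatedCStar (quiverAlgebra V))).comp φ)
    (fun a b hab => hφ (Subtype.ext hab))
    (s := fun i => ⟨loopShift i, le_generatedCStar _ (hS i)⟩)
    (o := ⟨L ⟨SingleObj.star _, SingleObj.star _, .nil⟩,
      le_generatedCStar _ (L_mem_quiverAlgebra _)⟩)
    (fun i h => ?_) (fun i => Subtype.ext (star_L_mul_L _)) (fun i => Subtype.ext (L_mul_L _ _))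
    (fun i => Subtype.ext (L_mul_L _ _)) (Subtype.ext star_loopShift_zero_mul_one)
    (fun i => hmem _ (hS i))
  have h1 : loopShift i (ξ ⟨SingleObj.star _, SingleObj.star _, .nil⟩) = 0 := by
    rw [show loopShift i = 0 from congrArg Subtype.val h]
    rfl
  rw [L_ξ_comp] at h1
  exact ξ_ne_zero _ h1

end Isometries

/-! ### The commuting right shifts, and decay on vacuum vectors. -/

section RightShift

variable {V : Type*} [Quiver V]

theorem leftMul_inj_left (w v v' u : FreeSemigroupoid V)
    (h : leftMul v w = some u) (h' : leftMul v' w = some u) : v = v' := by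
  obtain ⟨a, b, c, p, q, rfl, rfl, rfl⟩ := leftMul_eq_some_iff.1 h
  obtain ⟨a', b', c', p', q', rfl, hw, h2⟩ := leftMul_eq_some_iff.1 h'
  obtain rfl : a = a' := congrArg Sigma.fst hw
  obtain rfl : b = b' := congrArg (fun s => s.2.1) hw
  obtain rfl : c = c' := congrArg (fun s => s.2.1) h2
  have h3 := eq_of_heq (Sigma.mk.inj (eq_of_heq (Sigma.mk.inj hw).2)).2
  have h4 := eq_of_heq (Sigma.mk.inj (eq_of_heq (Sigma.mk.inj h2).2)).2
  subst h3
  rw [Quiver.Path.comp_inj_right.1 h4]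

/-- The right regular representation: `R w ξ_v = ξ_{vw}` when `vw` is defined, and `R w ξ_v = 0`
otherwise. -/
noncomputable def R (w : FreeSemigroupoid V) : FockSpace V →L[ℂ] FockSpace V :=
  partialShift fun v => leftMul v w

theorem R_ξ_of_some {w v u : FreeSemigroupoid V} (h : leftMul v w = some u) :
    R w (ξ v) = ξ u := by
  classical
  have := partialShift_single_of_some (f := fun v => leftMul v w) (leftMul_inj_left w) h
  rw [R, ξ, ξ]
  convert this

theorem R_ξ_of_none {w v : FreeSemigroupoid V} (h : leftMul v w = none) : R w (ξ v) = 0 := by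
  classical
  have := partialShift_single_of_none (f := fun v => leftMul v w) (leftMul_inj_left w) h
  rw [R, ξ]
  convert this

theorem R_ξ_comp {a b c : V} (p : Quiver.Path a b) (q : Quiver.Path b c) :
    R ⟨a, b, p⟩ (ξ ⟨b, c, q⟩) = ξ ⟨a, c, p.comp q⟩ :=
  R_ξ_of_some (leftMul_comp p q)

theorem R_ξ_of_ne {a b b' c : V} (p : Quiver.Path a b) (q : Quiver.Path b' c) (h : b ≠ b') :
    R ⟨a, b, p⟩ (ξ ⟨b', c, q⟩) = 0 :=
  R_ξ_of_none (by simp [leftMul, h])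

theorem R_apply_of_some {w v u : FreeSemigroupoid V} (g : FockSpace V)
    (h : leftMul v w = some u) : R w g u = g v :=
  partialShiftFun_apply (fun v => leftMul v w) (leftMul_inj_left w) g h

theorem R_apply_of_not {w u : FreeSemigroupoid V} (g : FockSpace V)
    (h : ∀ v, leftMul v w ≠ some u) : R w g u = 0 :=
  partialShiftFun_of_not (fun v => leftMul v w) g (by push Not; exact h)

theorem star_R_mul_R (w : FreeSemigroupoid V) : star (R w) * R w = R ⟨w.2.1, w.2.1, .nil⟩ := by
  rw [R, star_partialShift_mul_self (leftMul_inj_left w), R]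
  congr 1
  ext1 v
  obtain ⟨b, c, q⟩ := w
  obtain ⟨a, b', p⟩ := v
  by_cases h : c = a
  · subst h
    rw [leftMul_comp, leftMul_comp, Quiver.Path.nil_comp]
    rfl
  · simp [leftMul, h]

theorem commute_L_R (w v : FreeSemigroupoid V) : Commute (L w) (R v) := by
  refine clm_ext_ξ fun u => ?_
  obtain ⟨a, b, p⟩ := w
  obtain ⟨c, d, q⟩ := v
  obtain ⟨e, f, r⟩ := u
  rw [mul_apply_eq_comp, mul_apply_eq_comp]
  by_cases h1 : d = e
  · subst h1
    rw [R_ξ_comp]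
    by_cases h2 : f = a
    · subst h2
      rw [L_ξ_comp, L_ξ_comp, R_ξ_comp, Quiver.Path.comp_assoc]
    · rw [L_ξ_of_ne _ _ h2, L_ξ_of_ne _ _ h2, map_zero]
  · rw [R_ξ_of_ne _ _ h1, map_zero]
    by_cases h2 : f = a
    · subst h2
      rw [L_ξ_comp, R_ξ_of_ne _ _ h1]
    · rw [L_ξ_of_ne _ _ h2, map_zero]

/-- Commuting with `R w` is a norm-closed condition that passes from the generators to the algebra.
-/
theorem commute_R_of_mem {T : FockSpace V →L[ℂ] FockSpace V} (hT : T ∈ quiverAlgebra V)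
    (w : FreeSemigroupoid V) : Commute T (R w) := by
  have hcl : IsClosed {T : FockSpace V →L[ℂ] FockSpace V | T * R w = R w * T} :=
    isClosed_eq (continuous_mul_const _) (continuous_const_mul _)
  refine closure_minimal (fun S hS => ?_) hcl hT
  change Commute S (R w)
  induction hS using NonUnitalAlgebra.adjoin_induction with
  | mem x hx =>
    obtain ⟨a, b, e, rfl⟩ | ⟨a, rfl⟩ := hx
    all_goals exact commute_L_R _ _
  | add x y _ _ hx hy => exact hx.add_left hy
  | zero => exact Commute.zero_left _
  | mul x y _ _ hx hy => exact hx.mul_left hy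
  | smul r x _ hx => exact hx.smul_left r

/-- The vacuum vector at a vertex. -/
noncomputable abbrev vac (x : V) : FockSpace V := ξ ⟨x, x, .nil⟩

theorem R_vac {a b : V} (p : Quiver.Path a b) : R ⟨a, b, p⟩ (vac b) = ξ ⟨a, b, p⟩ := by
  rw [R_ξ_comp, Quiver.Path.comp_nil]

theorem norm_ξ (w : FreeSemigroupoid V) : ‖(ξ w : FockSpace V)‖ = 1 := by
  have h := inner_self_eq_norm_sq_to_K (𝕜 := ℂ) (ξ w : FockSpace V)
  rw [inner_ξ_left, ξ_apply_self] at h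
  have h1 : ‖(ξ w : FockSpace V)‖ ^ 2 = 1 := Complex.ofReal_injective (by
    rw [Complex.ofReal_pow, Complex.ofReal_one]
    exact h.symm)
  exact (pow_eq_one_iff_of_nonneg (norm_nonneg _) two_ne_zero).1 h1

-- A generator kills all vacuum vectors but one. In a product the right factor already gives decay,
-- and norm limits preserve it since vacuum vectors have norm one.
open Filter Topology in
theorem tendsto_vac_of_mem {T : FockSpace V →L[ℂ] FockSpace V} (hT : T ∈ quiverAlgebra V) :
    Tendsto (fun x : V => T (vac x)) cofinite (𝓝 0) := by
  have hadj : ∀ S ∈ NonUnitalAlgebra.adjoin ℂ (generators V),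
      Tendsto (fun x : V => S (vac x)) cofinite (𝓝 0) := by
    intro S hS
    induction hS using NonUnitalAlgebra.adjoin_induction with
    | mem S hS =>
      have hL : ∀ {a b : V} (p : Quiver.Path a b),
          Tendsto (fun x : V => L ⟨a, b, p⟩ (vac x)) cofinite (𝓝 0) := by
        intro a b p
        refine tendsto_const_nhds.congr' ?_
        filter_upwards [(Set.finite_singleton a).compl_mem_cofinite] with x hx
        exact (L_ξ_of_ne _ _ hx).symm
      obtain ⟨a, b, e, rfl⟩ | ⟨a, rfl⟩ := hS
      all_goals exact hL _
    | add S T _ _ hS hT => simpa using hS.add hT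
    | zero => exact tendsto_const_nhds
    | mul S T _ _ _ hT => simpa [Function.comp_def] using (S.continuous.tendsto 0).comp hT
    | smul r S _ hS => simpa using hS.const_smul r
  rw [Metric.tendsto_nhds]
  intro ε hε
  obtain ⟨S, hS, hTS⟩ := Metric.mem_closure_iff.1 hT (ε / 2) (half_pos hε)
  filter_upwards [Metric.tendsto_nhds.1 (hadj S hS) (ε / 2) (half_pos hε)] with x hx
  rw [dist_zero_right] at hx ⊢
  have h1 : ‖(T - S) (vac x)‖ ≤ ‖T - S‖ := by
    simpa [norm_ξ] using (T - S).le_opNorm (vac x)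
  rw [dist_eq_norm] at hTS
  calc ‖T (vac x)‖ = ‖(T - S) (vac x) + S (vac x)‖ := by simp
    _ ≤ ‖(T - S) (vac x)‖ + ‖S (vac x)‖ := norm_add_le _ _
    _ < ε := by linarith

end RightShift

/-! ### The initial projection and the vacuum vectors. -/

section Projections

/-- `U` need not commute with `star R`, but commuting with `star R * R` suffices. From `U R = R U`
one gets `P R = P R P`. Also `star R * P * R = star R * R * P`, which makes `R P - P R P` vanish by
the C*-identity. -/
theorem commute_star_mul_self_of_commute {A : Type*} [CStarAlgebra A] {U R : A}
    (h1 : U * (star U * U) = U) (hR : Commute U R) (hQ : Commute U (star R * R)) :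
    Commute (star U * U) R := by
  obtain ⟨P, hP⟩ : ∃ P, P = star U * U := ⟨_, rfl⟩
  have hPs : star P = P := by simp [hP]
  have hUP : U * P = U := by rw [hP, h1]
  have hPP : P * P = P := by
    nth_rw 1 [hP]
    rw [mul_assoc, hUP, hP]
  have hRPR : star R * P * R = star R * R * P := by
    have hQ' : Commute (star U) (star R * R) := by
      simpa using hQ.star_star
    calc star R * P * R = star (U * R) * (U * R) := by rw [hP, star_mul]; noncomm_ring
      _ = star U * (star R * R) * U := by rw [hR.eq, star_mul]; noncomm_ring
      _ = star R * R * P := by rw [hQ'.eq, mul_assoc, hP]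
  have hA : R * P - P * R * P = 0 := by
    rw [← CStarRing.star_mul_self_eq_zero_iff]
    calc star (R * P - P * R * P) * (R * P - P * R * P)
        = P * (star R * R) * P - P * (star R * P * R) * P - P * (star R * P * R) * P
          + P * (star R * (P * P) * R) * P := by
          simp only [star_sub, star_mul, hPs]
          noncomm_ring
      _ = 0 := by
          rw [hPP, hRPR]
          have : P * (star R * R * P) * P = P * (star R * R) * P := by
            rw [← mul_assoc, mul_assoc _ P P, hPP]
          rw [this]
          abel
  have hB : P * R = P * R * P := by
    have h2 : U * R = U * R * P := by rw [hR.eq, mul_assoc, hUP]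
    have h3 := congrArg (star U * ·) h2
    simpa only [← mul_assoc, ← hP] using h3
  rw [← hP]
  exact hB.trans (sub_eq_zero.1 hA).symm

theorem mul_eq_self_of_mul_star_le {H : Type*} [NormedAddCommGroup H] [InnerProductSpace ℂ H]
    [CompleteSpace H] {U P : H →L[ℂ] H} (hPP : P * P = P)
    (h : U * star U ≤ P) : P * U = U := by
  have h1 := star_right_conjugate_le_conjugate h (1 - P)
  have h2 : (1 - P) * P = 0 := by rw [sub_mul, one_mul, hPP, sub_self]
  have h3 : star (star U * star (1 - P)) * (star U * star (1 - P)) = 0 := by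
    refine le_antisymm ?_ (star_mul_self_nonneg _)
    calc star (star U * star (1 - P)) * (star U * star (1 - P))
        = (1 - P) * (U * star U) * star (1 - P) := by
          simp only [star_mul, star_star, mul_assoc]
      _ ≤ (1 - P) * P * star (1 - P) := h1
      _ = 0 := by rw [h2, zero_mul]
  rw [CStarRing.star_mul_self_eq_zero_iff] at h3
  have h4 := congrArg star h3
  rw [star_mul, star_star, star_star, star_zero, sub_mul, one_mul, sub_eq_zero] at h4
  exact h4.symm

variable {V : Type*} [Quiver V] {P : FockSpace V →L[ℂ] FockSpace V}

theorem inner_left_of_star_eq (hP : star P = P) (f g : FockSpace V) :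
    inner ℂ (P f) g = inner ℂ f (P g) := by
  rw [← ContinuousLinearMap.adjoint_inner_right, ← ContinuousLinearMap.star_eq_adjoint, hP]

/-- The coefficient of `P (vac x)` at a nontrivial path `w` is, up to conjugation, the coefficient
at `x` of a vector in the range of `R w`, hence zero. So `P (vac x)` is a multiple `c` of `vac x`,
with `c * c = c`. -/
theorem projection_vac (hP : star P = P) (hPP : P * P = P) (hPR : ∀ w, Commute P (R w)) (x : V) :
    P (vac x) = vac x ∨ P (vac x) = 0 := by
  have h0 : ∀ w : FreeSemigroupoid V, w ≠ ⟨x, x, .nil⟩ → P (vac x) w = 0 := by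
    rintro ⟨a, b, p⟩ hw
    rw [← inner_ξ_left, ← R_vac, ← inner_left_of_star_eq hP, ← mul_apply_eq_comp, (hPR _).eq,
      mul_apply_eq_comp, ← inner_conj_symm, inner_ξ_left, R_apply_of_not, map_zero]
    intro v hv
    obtain ⟨a', b', c, p', q, rfl, h1, h2⟩ := leftMul_eq_some_iff.1 hv
    obtain rfl : x = a' := congrArg Sigma.fst h2
    obtain rfl : x = c := congrArg (fun s => s.2.1) h2
    have h3 := eq_of_heq (Sigma.mk.inj (eq_of_heq (Sigma.mk.inj h2).2)).2
    have h4 : p'.length = 0 := by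
      have := congrArg Quiver.Path.length h3
      rw [Quiver.Path.length_comp] at this
      simp at this
      omega
    obtain rfl := p'.eq_of_length_zero h4
    rw [p'.eq_nil_of_length_zero h4] at h1
    exact hw h1
  have hc : P (vac x) = P (vac x) ⟨x, x, .nil⟩ • vac x := by
    ext w
    by_cases hw : w = ⟨x, x, .nil⟩
    · subst hw
      simp [ξ_apply_self]
    · rw [h0 w hw]
      simp [ξ_apply_of_ne hw]
  obtain ⟨c, hc'⟩ : ∃ c, c = P (vac x) ⟨x, x, .nil⟩ := ⟨_, rfl⟩
  rw [← hc'] at hc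
  have h2 : P (P (vac x)) = P (vac x) := by rw [← mul_apply_eq_comp, hPP]
  rw [hc, map_smul, hc, smul_smul] at h2
  have h3 : c * c = c := smul_left_injective ℂ (ξ_ne_zero (⟨x, x, .nil⟩ : FreeSemigroupoid V)) h2
  rcases eq_or_ne c 0 with h | h
  · right
    rw [hc, h, zero_smul]
  · left
    rw [hc, (mul_eq_left₀ h).1 h3, one_smul]

theorem projection_ξ (hPR : ∀ w, Commute P (R w)) (w : FreeSemigroupoid V) :
    P (ξ w) = R w (P (vac w.2.1)) := by
  obtain ⟨a, b, p⟩ := w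
  rw [← R_vac, ← mul_apply_eq_comp, (hPR _).eq, mul_apply_eq_comp]

end Projections

/-! ### Exponential against linear growth of path sets. -/

section Counting

variable {V : Type*} [Quiver V]

/-- Two operators in the commutant of the right shifts which are partial isometries with a common
initial projection `P`, and with orthogonal ranges contained in that of `P`. -/
structure OrthogonalIsometries (T : Fin 2 → FockSpace V →L[ℂ] FockSpace V)
    (P : FockSpace V →L[ℂ] FockSpace V) : Prop where
  star_mul_self : ∀ i, star (T i) * T i = P
  star_mul_of_ne : ∀ i j, i ≠ j → star (T i) * T j = 0
  mul_proj : ∀ i, T i * P = T i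
  proj_mul : ∀ i, P * T i = T i
  commute : ∀ i w, Commute (T i) (R w)
  commute_proj : ∀ w, Commute P (R w)

namespace OrthogonalIsometries

variable {T : Fin 2 → FockSpace V →L[ℂ] FockSpace V} {P : FockSpace V →L[ℂ] FockSpace V}

theorem star_proj (h : OrthogonalIsometries T P) : star P = P := by
  rw [← h.star_mul_self 0, star_mul, star_star]

theorem proj_mul_self (h : OrthogonalIsometries T P) : P * P = P := by
  nth_rw 1 [← h.star_mul_self 0]
  rw [mul_assoc, h.mul_proj, h.star_mul_self]

theorem inner_apply (h : OrthogonalIsometries T P) (i j : Fin 2) (f g : FockSpace V) :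
    inner ℂ (T i f) (T j g) = if i = j then inner ℂ f (P g) else 0 := by
  rw [← ContinuousLinearMap.adjoint_inner_right, ← ContinuousLinearMap.star_eq_adjoint,
    ← mul_apply_eq_comp]
  split_ifs with hij
  · rw [hij, h.star_mul_self]
  · rw [h.star_mul_of_ne i j hij]
    exact inner_zero_right _

theorem proj_ξ (h : OrthogonalIsometries T P) {w : FreeSemigroupoid V}
    (hw : P (vac w.2.1) = vac w.2.1) : P (ξ w) = ξ w := by
  rw [projection_ξ h.commute_proj, hw]
  exact R_vac w.2.2

theorem proj_ξ_eq_zero (h : OrthogonalIsometries T P) {w : FreeSemigroupoid V}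
    (hw : P (vac w.2.1) ≠ vac w.2.1) : P (ξ w) = 0 := by
  rw [projection_ξ h.commute_proj,
    (projection_vac h.star_proj h.proj_mul_self h.commute_proj _).resolve_left hw, map_zero]

theorem norm_apply_ξ (h : OrthogonalIsometries T P) (i : Fin 2) {w : FreeSemigroupoid V}
    (hw : P (vac w.2.1) = vac w.2.1) : ‖T i (ξ w)‖ = 1 := by
  have h1 := inner_self_eq_norm_sq_to_K (𝕜 := ℂ) (T i (ξ w))
  rw [h.inner_apply, if_pos rfl, h.proj_ξ hw, inner_ξ_left, ξ_apply_self] at h1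
  have h2 : ‖T i (ξ w)‖ ^ 2 = 1 := Complex.ofReal_injective (by
    rw [Complex.ofReal_pow, Complex.ofReal_one]
    exact h1.symm)
  exact (pow_eq_one_iff_of_nonneg (norm_nonneg _) two_ne_zero).1 h2

theorem of_apply_vac_ne_zero (h : OrthogonalIsometries T P) (i : Fin 2) {x : V}
    {w : FreeSemigroupoid V} (hw : T i (vac x) w ≠ 0) : w.1 = x ∧ P (vac w.2.1) = vac w.2.1 := by
  constructor
  · by_contra hne
    apply hw
    have h1 : T i (vac x) = R ⟨x, x, .nil⟩ (T i (vac x)) := by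
      rw [← mul_apply_eq_comp, ← (h.commute i _).eq, mul_apply_eq_comp, R_vac]
    rw [h1, R_apply_of_not]
    intro v hv
    obtain ⟨a, b, c, p, q, rfl, h2, rfl⟩ := leftMul_eq_some_iff.1 hv
    exact hne (congrArg Sigma.fst h2).symm
  · by_contra hne
    apply hw
    rw [← inner_ξ_left, ← h.proj_mul, mul_apply_eq_comp, ← inner_left_of_star_eq h.star_proj,
      h.proj_ξ_eq_zero hne, inner_zero_left]

/-- `T i` commutes with `R w`, so `T i (ξ w)` is the translate by `w` of the image of a vacuum
vector. -/
theorem apply_ξ_apply (h : OrthogonalIsometries T P) (i : Fin 2) {v w u : FreeSemigroupoid V}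
    (hu : leftMul v w = some u) : T i (ξ w) u = T i (vac w.2.1) v := by
  have h1 : T i (ξ w) = R w (T i (vac w.2.1)) := by
    rw [← mul_apply_eq_comp, ← (h.commute i _).eq, mul_apply_eq_comp]
    congr 1
    exact (R_vac w.2.2).symm
  rw [h1, R_apply_of_some _ hu]

theorem bessel (h : OrthogonalIsometries T P) (D : Finset (FreeSemigroupoid V))
    (hD : ∀ w ∈ D, P (vac w.2.1) = vac w.2.1) (b : FreeSemigroupoid V) :
    ∑ i : Fin 2, ∑ w ∈ D, ‖T i (ξ w) b‖ ^ 2 ≤ 1 := by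
  classical
  let v : Fin 2 × D → FockSpace V := fun p => T p.1 (ξ p.2)
  have hv : Orthonormal ℂ v := by
    rw [orthonormal_iff_ite]
    rintro ⟨i, w⟩ ⟨j, w'⟩
    simp only [v]
    rw [h.inner_apply, h.proj_ξ (hD _ w'.2), inner_ξ_left]
    by_cases hij : i = j
    · by_cases hw : w = w'
      · simp [hij, hw, ξ_apply_self]
      · simp [hij, hw, ξ_apply_of_ne (fun h => hw (Subtype.ext h))]
    · simp [hij]
  have h1 := hv.sum_inner_products_le (ξ b) (s := Finset.univ)
  rw [norm_ξ, one_pow, Fintype.sum_prod_type] at h1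
  refine le_of_eq_of_le (Finset.sum_congr rfl fun i _ => ?_) h1
  rw [← Finset.sum_coe_sort D]
  refine Finset.sum_congr rfl fun w _ => ?_
  rw [norm_inner_symm, inner_ξ_left]

-- `T i (vac x)` is a unit vector, so finitely many coordinates carry most of its mass. The value
-- 3/4 matters only in that its double exceeds 1.
open Filter in
theorem eventually_exists_mass (h : OrthogonalIsometries T P) (i : Fin 2) {x : V}
    (hx : P (vac x) = vac x) : ∀ᶠ m : ℕ in atTop, ∃ A : Finset (FreeSemigroupoid V),
      (∀ a ∈ A, T i (vac x) a ≠ 0 ∧ a.2.2.length < m) ∧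
        3 / 4 ≤ ∑ a ∈ A, ‖T i (vac x) a‖ ^ 2 := by
  classical
  have h1 := hasSum_norm_sq (T i (vac x))
  rw [h.norm_apply_ξ i hx, one_pow] at h1
  obtain ⟨A, hA⟩ := (h1.eventually_const_le (show (3 / 4 : ℝ) < 1 by norm_num)).exists
  filter_upwards [eventually_gt_atTop (A.sup fun a => a.2.2.length)] with m hm
  refine ⟨A.filter fun a => T i (vac x) a ≠ 0, fun a ha => ?_, ?_⟩
  · obtain ⟨ha1, ha2⟩ := Finset.mem_filter.1 ha
    exact ⟨ha2, (Finset.le_sup (f := fun a : FreeSemigroupoid V => a.2.2.length) ha1).trans_lt hm⟩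
  · rwa [Finset.sum_filter_of_ne]
    intro a _ ha h0
    simp [h0] at ha

theorem mass_le (h : OrthogonalIsometries T P) (i : Fin 2) {w : FreeSemigroupoid V}
    {A D : Finset (FreeSemigroupoid V)} (hA : ∀ a ∈ A, T i (vac w.2.1) a ≠ 0)
    (hD : ∀ a ∈ A, ∀ u, leftMul a w = some u → u ∈ D) :
    ∑ a ∈ A, ‖T i (vac w.2.1) a‖ ^ 2 ≤ ∑ b ∈ D, ‖T i (ξ w) b‖ ^ 2 := by
  classical
  have hex : ∀ a ∈ A, ∃ u, leftMul a w = some u := by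
    intro a ha
    obtain ⟨b, c, p⟩ := a
    obtain ⟨d, e, q⟩ := w
    obtain rfl : b = e := (h.of_apply_vac_ne_zero i (hA _ ha)).1
    exact ⟨_, leftMul_comp q p⟩
  -- The default `w` is never attained on `A`, where the product is always defined.
  have hget : ∀ a ∈ A, leftMul a w = some ((leftMul a w).getD w) := by
    intro a ha
    obtain ⟨u, hu⟩ := hex a ha
    rw [hu, Option.getD_some]
  calc ∑ a ∈ A, ‖T i (vac w.2.1) a‖ ^ 2
      = ∑ a ∈ A, ‖T i (ξ w) ((leftMul a w).getD w)‖ ^ 2 :=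
        Finset.sum_congr rfl fun a ha => by rw [h.apply_ξ_apply i (hget a ha)]
    _ = ∑ b ∈ A.image fun a => (leftMul a w).getD w, ‖T i (ξ w) b‖ ^ 2 := by
        refine (Finset.sum_image (f := fun b => ‖T i (ξ w) b‖ ^ 2) ?_).symm
        intro a ha a' ha' haa
        have haa : (leftMul a w).getD w = (leftMul a' w).getD w := haa
        exact leftMul_inj_left w a a' _ (hget a ha) (haa ▸ hget a' ha')
    _ ≤ _ := by
        refine Finset.sum_le_sum_of_subset_of_nonneg ?_ fun _ _ _ => by positivity
        intro b hb
        obtain ⟨a, ha, rfl⟩ := Finset.mem_image.1 hb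
        exact hD a ha _ (hget a ha)

/-- If the vertices `x` with `P ξ_x = ξ_x` form a nonempty finite set, there is a double cycle. -/
theorem hasDoubleCycle (h : OrthogonalIsometries T P) (hfin : {x | P (vac x) = vac x}.Finite)
    (hne : {x | P (vac x) = vac x}.Nonempty) : HasDoubleCycle V := by
  classical
  by_contra hV
  let _ : LE V := ⟨fun a b => Nonempty (Quiver.Path a b)⟩
  have : IsTrans V LE.le := ⟨fun a b c ⟨p⟩ ⟨q⟩ => ⟨p.comp q⟩⟩
  obtain ⟨x, hx, hmax⟩ := hfin.exists_maximal hne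
  let D : ℕ → Set (FreeSemigroupoid V) :=
    fun n => {w | w.1 = x ∧ P (vac w.2.1) = vac w.2.1 ∧ w.2.2.length < n}
  have hinj : ∀ n, Set.InjOn (fun w : FreeSemigroupoid V => w.2.2.length) (D n) := by
    rintro n ⟨a, b, p⟩ ⟨rfl, hb, -⟩ ⟨c, d, q⟩ ⟨rfl, hd, -⟩ hl
    -- By maximality of `x`, every vertex of the set reachable from `x` leads back to `x`.
    obtain ⟨r⟩ := hmax hb ⟨p⟩
    obtain ⟨s⟩ := hmax hd ⟨q⟩
    exact eq_of_not_hasDoubleCycle hV p q r s hl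
  have hmaps : ∀ n, Set.MapsTo (fun w : FreeSemigroupoid V => w.2.2.length) (D n) (Set.Iio n) :=
    fun n w hw => hw.2.2
  have hDfin : ∀ n, (D n).Finite := fun n =>
    Set.Finite.of_injOn (hmaps n) (hinj n) (Set.finite_Iio n)
  let F : ℕ → Finset (FreeSemigroupoid V) := fun n => (hDfin n).toFinset
  have hF : ∀ {n w}, w ∈ F n ↔ w ∈ D n := fun {n w} => (hDfin n).mem_toFinset
  have hcard : ∀ n, (F n).card ≤ n := by
    intro n
    refine (Finset.card_le_card_of_injOn (t := Finset.range n) (fun w => w.2.2.length)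
      (fun w hw => by simpa using (hF.1 hw).2.2) ?_).trans_eq (Finset.card_range n)
    intro w hw w' hw' hl
    exact hinj n (hF.1 hw) (hF.1 hw') hl
  -- Finiteness of the vertex set gives one `m` valid for all its vertices and both operators.
  obtain ⟨m, hm⟩ := ((Filter.eventually_all_finite hfin).2 fun y hy =>
    Filter.eventually_all.2 fun i => h.eventually_exists_mass i hy).exists
  have hstep : ∀ n, 3 / 2 * ((F n).card : ℝ) ≤ (F (n + m)).card := by
    intro n
    have hlow : ∀ i, ∀ w ∈ F n, 3 / 4 ≤ ∑ b ∈ F (n + m), ‖T i (ξ w) b‖ ^ 2 := by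
      intro i w hw
      obtain ⟨hw1, hw2, hw3⟩ := hF.1 hw
      obtain ⟨A, hA, hA2⟩ := hm _ hw2 i
      refine hA2.trans (h.mass_le i (fun a ha => (hA a ha).1) ?_)
      intro a ha u hu
      have h1 := (h.of_apply_vac_ne_zero i (hA a ha).1).2
      have h2 := (hA a ha).2
      obtain ⟨a', b', c', p, q, rfl, rfl, rfl⟩ := leftMul_eq_some_iff.1 hu
      refine hF.2 ⟨hw1, h1, ?_⟩
      simp only [Quiver.Path.length_comp] at hw3 h2 ⊢
      omega
    calc 3 / 2 * ((F n).card : ℝ) = ∑ i : Fin 2, ∑ w ∈ F n, (3 / 4 : ℝ) := by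
          simp
          ring
      _ ≤ ∑ i : Fin 2, ∑ w ∈ F n, ∑ b ∈ F (n + m), ‖T i (ξ w) b‖ ^ 2 :=
          Finset.sum_le_sum fun i _ => Finset.sum_le_sum fun w hw => hlow i w hw
      _ = ∑ b ∈ F (n + m), ∑ i : Fin 2, ∑ w ∈ F n, ‖T i (ξ w) b‖ ^ 2 := by
          rw [Finset.sum_comm (s := F (n + m))]
          exact Finset.sum_congr rfl fun i _ => Finset.sum_comm
      _ ≤ ∑ b ∈ F (n + m), (1 : ℝ) :=
          Finset.sum_le_sum fun b _ => h.bessel (F n) (fun w hw => (hF.1 hw).2.1) b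
      _ = (F (n + m)).card := by simp
  have hgrow : ∀ j : ℕ, (3 / 2 : ℝ) ^ j ≤ (F (1 + j * m)).card := by
    intro j
    induction j with
    | zero =>
      -- Lengths are strictly below the index, so the trivial path enters at index 1; starting at 0
      -- would give an empty set.
      have : (⟨x, x, .nil⟩ : FreeSemigroupoid V) ∈ F (1 + 0 * m) := hF.2 ⟨rfl, hx, by simp⟩
      rw [pow_zero]
      exact_mod_cast Finset.card_pos.2 ⟨_, this⟩
    | succ j ih =>
      calc (3 / 2 : ℝ) ^ (j + 1) = 3 / 2 * (3 / 2) ^ j := pow_succ' _ _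
        _ ≤ 3 / 2 * (F (1 + j * m)).card := by gcongr
        _ ≤ (F (1 + j * m + m)).card := hstep _
        _ = (F (1 + (j + 1) * m)).card := by rw [Nat.succ_mul, ← add_assoc]
  have hlim : Filter.Tendsto (fun j : ℕ => (1 + j * m : ℝ) / (3 / 2) ^ j) Filter.atTop
      (nhds 0) := by
    have h1 := tendsto_pow_const_div_const_pow_of_one_lt 0 (show (1 : ℝ) < 3 / 2 by norm_num)
    have h2 := tendsto_pow_const_div_const_pow_of_one_lt 1 (show (1 : ℝ) < 3 / 2 by norm_num)
    have h3 := h1.add (h2.mul_const (m : ℝ))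
    rw [zero_mul, add_zero] at h3
    refine h3.congr fun j => ?_
    ring
  obtain ⟨j, hj⟩ := (hlim.eventually_lt_const (show (0 : ℝ) < 1 by norm_num)).exists
  rw [div_lt_one (by positivity)] at hj
  have h1 : ((F (1 + j * m)).card : ℝ) ≤ 1 + j * m := by exact_mod_cast hcard (1 + j * m)
  linarith [hgrow j]

end OrthogonalIsometries

theorem hasDoubleCycle_of_partialIsometries {U W : FockSpace V →L[ℂ] FockSpace V}
    (hU : U ∈ quiverAlgebra V) (hW : W ∈ quiverAlgebra V) (hU0 : U ≠ 0)
    (hUp : IsPartialIsometry U) (hWp : IsPartialIsometry W) (hUW : star U * U = star W * W)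
    (hUle : U * star U ≤ star U * U) (hWle : W * star W ≤ star W * W)
    (horth : star U * W = 0) : HasDoubleCycle V := by
  have hUp' : U * (star U * U) = U := (mul_assoc _ _ _).symm.trans hUp
  have hWp' : W * (star W * W) = W := (mul_assoc _ _ _).symm.trans hWp
  have hPP : star U * U * (star U * U) = star U * U := by rw [mul_assoc, hUp']
  have h : OrthogonalIsometries ![U, W] (star U * U) := by
    refine ⟨?_, ?_, ?_, ?_, ?_, fun w => ?_⟩
    · exact Fin.forall_fin_two.2 ⟨rfl, hUW.symm⟩
    · have h' : star W * U = 0 := by simpa using congrArg star horth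
      intro i j hij
      fin_cases i <;> fin_cases j <;> first | exact (hij rfl).elim | exact horth | exact h'
    · exact Fin.forall_fin_two.2 ⟨hUp', hUW ▸ hWp'⟩
    · exact Fin.forall_fin_two.2 ⟨mul_eq_self_of_mul_star_le hPP hUle,
        mul_eq_self_of_mul_star_le hPP (hUW ▸ hWle)⟩
    · exact Fin.forall_fin_two.2 ⟨commute_R_of_mem hU, commute_R_of_mem hW⟩
    · refine commute_star_mul_self_of_commute hUp' (commute_R_of_mem hU w) ?_
      rw [star_R_mul_R]
      exact commute_R_of_mem hU _
  refine h.hasDoubleCycle ?_ ?_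
  -- `U` maps a vacuum vector fixed by the projection to a unit vector, which decay allows at only
  -- finitely many vertices.
  · have h1 := Metric.tendsto_nhds.1 (tendsto_vac_of_mem hU) 1 one_pos
    refine Set.Finite.subset h1 fun x hx hlt => ?_
    have hlt : dist (U (vac x)) 0 < 1 := hlt
    rw [dist_zero_right] at hlt
    exact hlt.ne (h.norm_apply_ξ 0 hx)
  · by_contra hempty
    apply hU0
    have hP : star U * U = 0 := clm_ext_ξ fun w =>
      h.proj_ξ_eq_zero fun hw => hempty ⟨_, hw⟩
    rw [← hUp', hP, mul_zero]

end Counting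

end QuiverAlgebra

theorem mainTheorem3 (V : Type*) [Quiver V] [Countable V] [∀ a b : V, Countable (a ⟶ b)] :
    List.TFAE
      [QuiverAlgebra.HasDoubleCycle V,
       QuiverAlgebra.IsPartlyFree V,
       ∃ U ∈ QuiverAlgebra.quiverAlgebra V, ∃ W ∈ QuiverAlgebra.quiverAlgebra V,
         U ≠ 0 ∧ W ≠ 0 ∧
         QuiverAlgebra.IsPartialIsometry U ∧ QuiverAlgebra.IsPartialIsometry W ∧
         star U * U = star W * W ∧ U * star U ≤ star U * U ∧ W * star W ≤ star W * W ∧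
         star U * W = 0] := by
  tfae_have 1 → 2 := QuiverAlgebra.HasDoubleCycle.isPartlyFree
  tfae_have 2 → 3 := QuiverAlgebra.IsPartlyFree.exists_partialIsometries
  tfae_have 3 → 1 := by
    rintro ⟨U, hU, W, hW, hU0, -, hUp, hWp, hUW, hUle, hWle, horth⟩
    exact QuiverAlgebra.hasDoubleCycle_of_partialIsometries hU hW hU0 hUp hWp hUW hUle hWle horth
  tfae_finish
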